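/- **Trust model.** Let $\Pi$ be a finite set of processes. A trust model $(\mathcal Q,\mathcal F)$ consists of a map $\mathcal Q$ assigning to every process $p$ a non-empty set $\mathcal Q(p)$ of subsets of $\Pi$ (the quorums of $p$), each containing $p$, and of a family $\mathcal F$ of subsets of $\Pi$ that is closed under taking subsets. For $F\in\mathcal F$, a process $p$ is *live* if some $Q\in\mathcal Q(p)$ satisfies $Q\cap F=\emptyset$. For $F\in\mathcal F$ and a map $S$ with $S(p)\in\mathcal Q(p)$ for all $p$, let $G_{F,S}$ be the graph on $\Pi\setminus F$ in which distinct $p,q$ are adjacent iff $S(p)\cap S(q)\not\subseteq F$. The *inconsistency number* $k_{max}$ of $(\mathcal Q,\mathcal F)$ is the largest independence number of a graph $G_{F,S}$. **Transactions.** A transaction is a tuple $tx=(s,\tau,I)$ of an issuer $s\in\Pi\cup\{\bot\}$, an output map $\tau:\Pi\to\mathbb Z_{\ge0}$ and a finite set $I$ of input transactions $tx'$, each incoming to $s$, i.e. $s\in\Pi$ and $tx'.\tau(s)>0$. It is *valid* if $\sum_{p}tx.\tau(p)=\sum_{tx'\in I}tx'.\tau(s)>0$. There is an initial transaction $tx_{init}=(\bot,\tau_{init},\emptyset)$.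 Distinct $tx,tx'$ *conflict* if $tx.s=tx'.s$ and $tx.I\cap tx'.I\ne\emptyset$; $tx$ *depends on* $tx'$ if a path of length at least one leads from $tx'$ to $tx$ along edges from inputs to the transactions using them. A set $T$ of transactions is *well-formed* if $tx_{init}\in T$; all other members are valid; inputs of members are members; no two members conflict; and for $tx,tx'\in T$, if $tx$ depends on $tx'$ then $tx\notin tx'.I$. The *spending number* of a collection $\Gamma$ of histories is the maximum, over $r\in\Pi$ and $tx$ with $tx.\tau(r)>0$, of the number of transactions of $r$ that have $tx$ as an input and appear in a member of $\Gamma$. **Accusations.** There are operations $\mathrm{sign}$ and $\mathrm{verify}$ such that $\mathrm{verify}(p,tx,\mathrm{sign}(p,tx))$ is true. An accusation is a pair $(AC,P)$ of a set $AC\subseteq\Pi$ and a finite set $P$ of pairs $(tx,\sigma)$. $\textit{verify-acc}(AC,P)$ is true iff for each $p\in AC$ the set $P$ contains two conflicting transactions issued by $p$ with valid signatures of $p$. The accusation *refers to* the transactions occurring in such pairs. **Protocol.** Each $p_i$ has variables $\textit{echoes}[\cdot],\textit{usedInp}[\cdot],\textit{signedRequests}[\cdot],\textit{pending},\textit{acHist}$,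 initially empty, and $\textit{trHist}$, initially $\{tx_{init}\}$. Its atomic steps are as follows. 1. On $\textit{transfer}(tx)$: send $[\mathrm{REQ},tx,\mathrm{sign}(p_i,tx)]$ to all. 2. On receiving $[\mathrm{REQ},tx,\sigma]$ from $p_j$: if $p_j=tx.s$, $\mathrm{verify}(p_j,tx,\sigma)$ holds and $(tx,\sigma)\notin\textit{signedRequests}[p_j]$, add $(tx,\sigma)$ to $\textit{signedRequests}[p_j]$; then, if $tx.I\cap\textit{usedInp}[p_j]=\emptyset$, add $tx.I$ to $\textit{usedInp}[p_j]$ and send $[\mathrm{ECHO},(tx,\sigma),\mathrm{sign}(p_i,tx)]$ to all. 3. On receiving $[\mathrm{ECHO},(tx,\sigma_s),\sigma]$ from $p_j$: if $\mathrm{verify}(p_j,tx,\sigma)$ and $\mathrm{verify}(tx.s,tx,\sigma_s)$ hold, add $tx$ to $\textit{echoes}[p_j]$ and $(tx,\sigma_s)$ to $\textit{signedRequests}[tx.s]$; then, if $tx.I\cap\textit{usedInp}[tx.s]=\emptyset$, add $tx.I$ to $\textit{usedInp}[tx.s]$ and send $[\mathrm{ECHO},(tx,\sigma_s),\mathrm{sign}(p_i,tx)]$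 to all. 4. If for some $Q\in\mathcal Q(p_i)$ one has $tx\in\textit{echoes}[q]$ for all $q\in Q$, and $tx\notin\textit{trHist}\cup\textit{pending}$: add $tx$ to $\textit{pending}$. 5. If $tx\in\textit{pending}$ is valid, $tx.I\subseteq\textit{trHist}$, and no transaction of $tx.s$ in $\textit{trHist}$ shares an input with $tx$: move $tx$ from $\textit{pending}$ to $\textit{trHist}$. 6. If $e=(tx,\sigma)$ and $e'=(tx',\sigma')$ are in $\textit{signedRequests}[p_j]$ with $tx\ne tx'$ and $tx.I\cap tx'.I\neq\emptyset$, and $a=(\{p_j\},\{e,e'\})\notin\textit{acHist}$: add $a$ to $\textit{acHist}$ and send $[\mathrm{ACC},a]$ to all. 7. On receiving $[\mathrm{ACC},a]$: if $\textit{verify-acc}(a)$ holds and $a\notin\textit{acHist}$, add $a$ to $\textit{acHist}$ and send $[\mathrm{ACC},a]$ to all. **Executions.** Consider an infinite asynchronous execution with faulty set $F\in\mathcal F$. Processes outside $F$ (the *correct* ones) follow the protocol, and none of the rules 4–6 stays enabled forever at a correct process without being executed. Processes in $F$ behave arbitrarily, but can only send those signatures of a correct process that this process created before. A correct process receives a message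 from $p$ only if $p$ sent it, and every message between correct processes is eventually received. A correct process $p$ only issues (i.e. invokes $\textit{transfer}$ on) valid transactions with issuer $p$, all of whose inputs are already in its $\textit{trHist}$, and which do not conflict with transactions it issued before. **Theorem.** Let $(\mathcal Q,\mathcal F)$ be a trust model with inconsistency number $k_{max}$. Then the protocol implements $k_{max}$-spending asset transfer. That is, in every execution as above with faulty set $F\in\mathcal F$, writing $T_p(t)$ and $A_p(t)$ for $\textit{trHist}$ and $\textit{acHist}$ of $p$ at time $t$, the history $T_p(t)$ of every correct $p$ is well-formed at all times $t$, and the following hold. - *Validity*: if a correct process issues $tx$, then every live correct process $q$ eventually adds $tx$ to $T_q$, or adds to $A_q$ an accusation referring to some transaction on which $tx$ depends. - *$k_{max}$-Spending*: for all $t$, the collection $\{T_p(t): p \text{ correct}\}$ has spending number at most $k_{max}$. - *Eventual Conviction*: if correct $p$ and $q$ add conflicting transactions $tx$ to $T_p$ and $tx'$ to $T_q$, then each of $A_p$ and $A_q$ eventually contains an accusation referring to $tx$ and an accusation referring to $tx'$. - *Accuracy*: for all correct $p$, all $t$ and all $(AC,P)\in A_p(t)$, $\textit{verify-acc}(AC,P)$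 is true, and it is true if and only if $AC\subseteq F$. Moreover, for every accusation $(AC,P)$ sent by any process, correct or faulty, if $\textit{verify-acc}(AC,P)$ is true then $AC\subseteq F$. - *Agreement*: if a correct process adds an accusation to its accusation history, then every correct process eventually does so. - *Integrity*: if $tx.s$ is correct, a correct process adds $tx$ to its history only if $tx.s$ previously issued $tx$. - *Monotonicity*: for correct $p$ and $t\le t'$, $A_p(t)\subseteq A_p(t')$. - *Termination*: if a correct process adds $tx$ to its history, then every live correct process $q$ eventually adds $tx$ to $T_q$, or adds to $A_q$ an accusation referring to $tx$ or to some transaction on which $tx$ depends. -/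

import Mathlib

namespace SpendingAssetTransfer

/-! Trust models and their graphs -/

/-- A trust model on a finite set `P` of processes: a quorum map, every process having at least one
quorum and belonging to each of its own quorums, and an inclusion-closed fault model. -/
structure TrustModel (P : Type*) where
  quorums : P → Set (Set P)
  quorums_nonempty : ∀ p, (quorums p).Nonempty
  self_mem : ∀ p, ∀ Q ∈ quorums p, p ∈ Q
  faults : Set (Set P)
  faults_closed : ∀ F ∈ faults, ∀ F' ⊆ F, F' ∈ faults

namespace TrustModel

variable {P : Type*} (M : TrustModel P)

/-- `p` is live in `F`: one of its quorums contains no member of `F`. -/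
def Live (F : Set P) (p : P) : Prop :=
  ∃ Q ∈ M.quorums p, Disjoint Q F

/-- `S` selects one quorum for every process. -/
def IsSelection (S : P → Set P) : Prop :=
  ∀ p, S p ∈ M.quorums p

end TrustModel

/-- The trust graph `G_{F,S}`: its nodes are the processes outside `F`; two distinct nodes are
adjacent iff their selected quorums meet outside `F`. -/
def trustGraph {P : Type*} (F : Set P) (S : P → Set P) : SimpleGraph {p : P // p ∉ F} where
  Adj p q := p ≠ q ∧ ¬ (S p ∩ S q ⊆ F)
  symm := ⟨fun p q h => ⟨h.1.symm, by rw [Set.inter_comm]; exact h.2⟩⟩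
  loopless := ⟨fun _ h => h.1 rfl⟩

/-- The highest independence number of a trust graph of the model. For a finite set of processes
the set below is bounded, so that the supremum is a maximum. -/
noncomputable def TrustModel.inconsistencyNumber {P : Type*} (M : TrustModel P) : ℕ :=
  sSup {m | ∃ F ∈ M.faults, ∃ S, M.IsSelection S ∧ m = (trustGraph F S).indepNum}

/-! Transactions and histories -/

/-- A set `Tx` of transactions over the processes `P`. Every transaction is a tuple of an issuer
(`none` stands for the system originator `⊥`), an output map and a finite set of inputs in `Tx`;
all inputs are incoming to the issuer. `init` is the initial transaction. -/
structure TxSystem (P Tx : Type*) where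
  issuer : Tx → Option P
  output : Tx → P → ℕ
  inputs : Tx → Finset Tx
  tuple_injective : Function.Injective fun tx => (issuer tx, output tx, inputs tx)
  inputs_incoming : ∀ tx, ∀ tx' ∈ inputs tx, ∃ r, issuer tx = some r ∧ 0 < output tx' r
  init : Tx
  init_issuer : issuer init = none
  init_inputs : inputs init = ∅

namespace TxSystem

variable {P Tx : Type*} (𝒯 : TxSystem P Tx)

/-- The amount sent to the issuer by the inputs. -/
def inValue (tx : Tx) : ℕ :=
  match 𝒯.issuer tx with
  | none => 0
  | some s => ∑ tx' ∈ 𝒯.inputs tx, 𝒯.output tx' s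

/-- The total amount spent. -/
def outValue [Fintype P] (tx : Tx) : ℕ :=
  ∑ p, 𝒯.output tx p

def Valid [Fintype P] (tx : Tx) : Prop :=
  0 < 𝒯.outValue tx ∧ 𝒯.outValue tx = 𝒯.inValue tx

/-- Distinct transactions of the same issuer with a common input. -/
def Conflict (tx tx' : Tx) : Prop :=
  tx ≠ tx' ∧ 𝒯.issuer tx = 𝒯.issuer tx' ∧ ∃ i, i ∈ 𝒯.inputs tx ∧ i ∈ 𝒯.inputs tx'

/-- `tx` depends on `tx'`: there is a path (of length at least one) from `tx'` to `tx` along edges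
that lead from an input to the transaction using it. -/
def DependsOn (tx tx' : Tx) : Prop :=
  Relation.TransGen (fun a b => a ∈ 𝒯.inputs b) tx' tx

structure WellFormed [Fintype P] (T : Set Tx) : Prop where
  init_mem : 𝒯.init ∈ T
  valid : ∀ tx ∈ T, tx ≠ 𝒯.init → 𝒯.Valid tx
  complete : ∀ tx ∈ T, ∀ tx' ∈ 𝒯.inputs tx, tx' ∈ T
  no_conflict : ∀ tx ∈ T, ∀ tx' ∈ T, ¬ 𝒯.Conflict tx tx'
  cycle_free : ∀ tx ∈ T, ∀ tx' ∈ T, 𝒯.DependsOn tx tx' → tx ∉ 𝒯.inputs tx'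

/-- The transactions issued by `r` that use `tx` as an input and appear in a history of `Γ`. -/
def spends (Γ : Set (Set Tx)) (r : P) (tx : Tx) : Set Tx :=
  {tx' | ∃ T ∈ Γ, tx' ∈ T ∧ tx ∈ 𝒯.inputs tx' ∧ 𝒯.issuer tx' = some r}

/-- The highest number of times that one process spends the same incoming transaction in `Γ`. -/
noncomputable def spendingNumber (Γ : Set (Set Tx)) : ℕ∞ :=
  ⨆ (r : P) (tx : Tx) (_ : 0 < 𝒯.output tx r), (𝒯.spends Γ r tx).encard

end TxSystem

/-! Signatures and accusations -/

/-- The operations of a signature scheme. That signatures of correct processes cannot be forged is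
a property of executions, see `Execution.Admissible.unforgeable`. -/
structure SigScheme (P Tx Sig : Type*) where
  sign : P → Tx → Sig
  verify : P → Tx → Sig → Bool
  verify_sign : ∀ p tx, verify p tx (sign p tx) = true

/-- A set `AC` of accused processes together with a set `proof` of signed transactions. -/
@[ext]
structure Accusation (P Tx Sig : Type*) where
  AC : Finset P
  proof : Finset (Tx × Sig)

section Accusations

variable {P Tx Sig : Type*} (𝒯 : TxSystem P Tx) (sg : SigScheme P Tx Sig)

/-- `e` and `e'` are conflicting transactions of `p`, both with a valid signature of `p`. -/
def IsEvidence (p : P) (e e' : Tx × Sig) : Prop :=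
  𝒯.issuer e.1 = some p ∧ 𝒯.Conflict e.1 e'.1 ∧
    sg.verify p e.1 e.2 = true ∧ sg.verify p e'.1 e'.2 = true

/-- The check `verify-acc`: the proof holds conflicting signed transactions of every accused
process. -/
def VerifyAcc (a : Accusation P Tx Sig) : Prop :=
  ∀ p ∈ a.AC, ∃ e ∈ a.proof, ∃ e' ∈ a.proof, IsEvidence 𝒯 sg p e e'

/-- `a` refers to `tx`: `tx` is one of the conflicting signed transactions of an accused process
contained in the proof. -/
def RefersTo (a : Accusation P Tx Sig) (tx : Tx) : Prop :=
  ∃ p ∈ a.AC, ∃ e ∈ a.proof, ∃ e' ∈ a.proof, e.1 = tx ∧ IsEvidence 𝒯 sg p e e'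

end Accusations

/-! The `k`-spending asset transfer abstraction -/

/-- What is observed of a run: `issued t p tx` says that `p` invokes `transfer(tx)` in step `t`;
`T t p` and `A t p` are the local histories of `p` at time `t`; `exhibited` is the set of
accusations that were sent by some process, correct or not. -/
structure Trace (P Tx Sig : Type*) where
  issued : ℕ → P → Tx → Prop
  T : ℕ → P → Set Tx
  A : ℕ → P → Set (Accusation P Tx Sig)
  exhibited : Set (Accusation P Tx Sig)

/-- The properties of `k`-spending asset transfer, for a trace with faulty set `F`. -/
structure IsKSpendingAssetTransfer {P Tx Sig : Type*} [Fintype P] (M : TrustModel P)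
    (𝒯 : TxSystem P Tx) (sg : SigScheme P Tx Sig) (F : Set P) (k : ℕ)
    (X : Trace P Tx Sig) : Prop where
  /-- Local histories of correct processes are transaction histories in the proper sense. -/
  wellFormed : ∀ p, p ∉ F → ∀ t, 𝒯.WellFormed (X.T t p)
  validity : ∀ t p tx, p ∉ F → X.issued t p tx → ∀ q, q ∉ F → M.Live F q →
    (∃ t', tx ∈ X.T t' q) ∨
      ∃ t', ∃ a ∈ X.A t' q, ∃ tx', 𝒯.DependsOn tx tx' ∧ RefersTo 𝒯 sg a tx'
  kSpending : ∀ t, 𝒯.spendingNumber {H | ∃ p, p ∉ F ∧ H = X.T t p} ≤ k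
  eventualConviction : ∀ p q, p ∉ F → q ∉ F → ∀ t t' tx tx', tx ∈ X.T t p → tx' ∈ X.T t' q →
    𝒯.Conflict tx tx' →
      ∀ r, (r = p ∨ r = q) →
        (∃ u, ∃ a ∈ X.A u r, RefersTo 𝒯 sg a tx) ∧ (∃ u, ∃ a ∈ X.A u r, RefersTo 𝒯 sg a tx')
  accuracy : ∀ p, p ∉ F → ∀ t, ∀ a ∈ X.A t p,
    VerifyAcc 𝒯 sg a ∧ (VerifyAcc 𝒯 sg a ↔ (a.AC : Set P) ⊆ F)
  /-- No accusation that anybody exhibits can pass verification against a correct process. -/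
  accuracy_exhibited : ∀ a ∈ X.exhibited, VerifyAcc 𝒯 sg a → (a.AC : Set P) ⊆ F
  agreement : ∀ p, p ∉ F → ∀ t, ∀ a ∈ X.A t p, ∀ q, q ∉ F → ∃ t', a ∈ X.A t' q
  integrity : ∀ p, p ∉ F → ∀ t, ∀ tx ∈ X.T t p, ∀ r, r ∉ F → 𝒯.issuer tx = some r →
    ∃ t' < t, X.issued t' r tx
  monotonicity : ∀ p, p ∉ F → ∀ t t', t ≤ t' → X.A t p ⊆ X.A t' p
  termination : ∀ p, p ∉ F → ∀ t, ∀ tx ∈ X.T t p, ∀ q, q ∉ F → M.Live F q →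
    (∃ t', tx ∈ X.T t' q) ∨
      ∃ t', ∃ a ∈ X.A t' q, ∃ tx', (tx' = tx ∨ 𝒯.DependsOn tx tx') ∧ RefersTo 𝒯 sg a tx'

/-! The protocol -/

inductive Message (P Tx Sig : Type*)
  /-- `[REQ, tx, σ]` -/
  | req (tx : Tx) (σ : Sig)
  /-- `[ECHO, (tx, σs), σ]`: `σs` is the signature of the issuer, `σ` the one of the sender. -/
  | echo (tx : Tx) (σs : Sig) (σ : Sig)
  /-- `[ACC, a]` -/
  | acc (a : Accusation P Tx Sig)

/-- The signed transactions that a message carries. -/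
def Message.signed {P Tx Sig : Type*} : Message P Tx Sig → Set (Tx × Sig)
  | .req tx σ => {(tx, σ)}
  | .echo tx σs σ => {(tx, σs), (tx, σ)}
  | .acc a => {e | e ∈ a.proof}

/-- The local variables of a process. -/
@[ext]
structure LocalState (P Tx Sig : Type*) where
  echoes : P → Set Tx
  usedInp : P → Set Tx
  pending : Set Tx
  trHist : Set Tx
  signedRequests : P → Set (Tx × Sig)
  acHist : Set (Accusation P Tx Sig)

/-- The steps of a process: an invocation of `transfer(tx)`, the receipt of a message from a
process, the three internal rules of the protocol, and a stuttering step. -/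
inductive Action (P Tx Sig : Type*)
  | transfer (tx : Tx)
  | receive (sender : P) (m : Message P Tx Sig)
  | collect (tx : Tx)
  | accept (tx : Tx)
  | accuse (j : P) (e e' : Tx × Sig)
  | idle

section Protocol

variable {P Tx Sig : Type*} [Fintype P] (M : TrustModel P) (𝒯 : TxSystem P Tx)
  (sg : SigScheme P Tx Sig)

def initialState : LocalState P Tx Sig where
  echoes := fun _ => ∅
  usedInp := fun _ => ∅
  pending := ∅
  trHist := {𝒯.init}
  signedRequests := fun _ => ∅
  acHist := ∅

/-- `arr[j] ← arr[j] ∪ s`. -/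
noncomputable def addAt {α : Type*} (arr : P → Set α) (j : P) (s : Set α) : P → Set α :=
  open Classical in Function.update arr j (arr j ∪ s)

/-- The block shared by the handlers of `REQ` and `ECHO`: if no input of `tx` is recorded as used
by the issuer `s`, record the inputs and echo the signed request. -/
noncomputable def echoIfFresh (i s : P) (tx : Tx) (σs : Sig) (st : LocalState P Tx Sig) :
    LocalState P Tx Sig × Set (Message P Tx Sig) :=
  open Classical in
  if ∀ x ∈ 𝒯.inputs tx, x ∉ st.usedInp s then
    ({ st with usedInp := addAt st.usedInp s {x | x ∈ 𝒯.inputs tx} },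
      {Message.echo tx σs (sg.sign i tx)})
  else (st, ∅)

/-- `p_i` receives `[REQ, tx, σ]` from `p_j`; the request has to come from, and be signed by, the
issuer of `tx`. -/
noncomputable def onReq (i j : P) (tx : Tx) (σ : Sig) (st : LocalState P Tx Sig) :
    LocalState P Tx Sig × Set (Message P Tx Sig) :=
  open Classical in
  if 𝒯.issuer tx = some j ∧ sg.verify j tx σ = true ∧ (tx, σ) ∉ st.signedRequests j then
    echoIfFresh 𝒯 sg i j tx σ
      { st with signedRequests := addAt st.signedRequests j {(tx, σ)} }
  else (st, ∅)

/-- `p_i` receives `[ECHO, (tx, σs), σ]` from `p_j`. -/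
noncomputable def onEcho (i j : P) (tx : Tx) (σs σ : Sig) (st : LocalState P Tx Sig) :
    LocalState P Tx Sig × Set (Message P Tx Sig) :=
  open Classical in
  match 𝒯.issuer tx with
  | none => (st, ∅)
  | some s =>
    if sg.verify j tx σ = true ∧ sg.verify s tx σs = true then
      echoIfFresh 𝒯 sg i s tx σs
        { st with
          echoes := addAt st.echoes j {tx}
          signedRequests := addAt st.signedRequests s {(tx, σs)} }
    else (st, ∅)

/-- A new accusation is stored and sent to everybody. -/
def storeAcc (a : Accusation P Tx Sig) (st : LocalState P Tx Sig) :
    LocalState P Tx Sig × Set (Message P Tx Sig) :=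
  ({ st with acHist := st.acHist ∪ {a} }, {Message.acc a})

/-- `p_i` receives `[ACC, a]`. -/
noncomputable def onAcc (a : Accusation P Tx Sig) (st : LocalState P Tx Sig) :
    LocalState P Tx Sig × Set (Message P Tx Sig) :=
  open Classical in
  if VerifyAcc 𝒯 sg a ∧ a ∉ st.acHist then storeAcc a st else (st, ∅)

/-- The function `ready`. -/
def Ready (st : LocalState P Tx Sig) (tx : Tx) : Prop :=
  (∀ tx' ∈ 𝒯.inputs tx, tx' ∈ st.trHist) ∧
  𝒯.Valid tx ∧
  ∀ tx' ∈ st.trHist, 𝒯.issuer tx = 𝒯.issuer tx' → ∀ x ∈ 𝒯.inputs tx, x ∉ 𝒯.inputs tx'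

/-- The accusation `({p_j}, {e, e'})`. -/
noncomputable def mkAcc (j : P) (e e' : Tx × Sig) : Accusation P Tx Sig :=
  open Classical in ⟨{j}, {e, e'}⟩

/-- When a step of `p_i` can be taken. An internal rule counts as enabled as long as it has an
effect. -/
def Enabled (i : P) (st : LocalState P Tx Sig) : Action P Tx Sig → Prop
  | .collect tx =>
      (∃ Q ∈ M.quorums i, ∀ q ∈ Q, tx ∈ st.echoes q) ∧ tx ∉ st.trHist ∧ tx ∉ st.pending
  | .accept tx => tx ∈ st.pending ∧ Ready 𝒯 st tx
  | .accuse j e e' =>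
      e ∈ st.signedRequests j ∧ e' ∈ st.signedRequests j ∧ e.1 ≠ e'.1 ∧
        (∃ x, x ∈ 𝒯.inputs e.1 ∧ x ∈ 𝒯.inputs e'.1) ∧ mkAcc j e e' ∉ st.acHist
  | _ => True

/-- The new local state of `p_i`, and the messages that `p_i` sends to all processes. -/
noncomputable def step (i : P) (st : LocalState P Tx Sig) :
    Action P Tx Sig → LocalState P Tx Sig × Set (Message P Tx Sig)
  | .transfer tx => (st, {Message.req tx (sg.sign i tx)})
  | .receive j (.req tx σ) => onReq 𝒯 sg i j tx σ st
  | .receive j (.echo tx σs σ) => onEcho 𝒯 sg i j tx σs σ st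
  | .receive _ (.acc a) => onAcc 𝒯 sg a st
  | .collect tx => ({ st with pending := st.pending ∪ {tx} }, ∅)
  | .accept tx => ({ st with trHist := st.trHist ∪ {tx}, pending := st.pending \ {tx} }, ∅)
  | .accuse j e e' => storeAcc (mkAcc j e e') st
  | .idle => (st, ∅)

end Protocol

/-! Executions -/

/-- An infinite execution. In step `t` the process `proc t` performs `act t` and sends to each
process `q` the messages in `sent t q`; `state t p` is the local state of `p` before step `t`.
For faulty processes, `act` and `state` carry no information. -/
structure Execution (P Tx Sig : Type*) where
  proc : ℕ → P
  act : ℕ → Action P Tx Sig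
  sent : ℕ → P → Set (Message P Tx Sig)
  state : ℕ → P → LocalState P Tx Sig

namespace Execution

variable {P Tx Sig : Type*} [Fintype P]

/-- In step `t`, the process `p` invokes `transfer(tx)`. -/
def Issues (E : Execution P Tx Sig) (t : ℕ) (p : P) (tx : Tx) : Prop :=
  E.proc t = p ∧ E.act t = .transfer tx

/-- In step `t`, the process `p` sends a signature of its own for `tx`, as the issuer in a request
or as the sender of an echo. A correct process creates signatures in no other way. -/
def Signs (E : Execution P Tx Sig) (sg : SigScheme P Tx Sig) (t : ℕ) (p : P) (tx : Tx) : Prop :=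
  E.proc t = p ∧ ∃ q, (Message.req tx (sg.sign p tx) ∈ E.sent t q ∨
    ∃ σs, Message.echo tx σs (sg.sign p tx) ∈ E.sent t q)

/-- Executions of the protocol in which all processes outside `F` are correct and those in `F`
behave arbitrarily, except that they cannot forge signatures of correct processes. -/
structure Admissible (E : Execution P Tx Sig) (M : TrustModel P) (𝒯 : TxSystem P Tx)
    (sg : SigScheme P Tx Sig) (F : Set P) : Prop where
  /-- Correct processes start in the initial state and follow the protocol. -/
  init : ∀ p, p ∉ F → E.state 0 p = initialState 𝒯
  frame : ∀ t p, p ∉ F → p ≠ E.proc t → E.state (t + 1) p = E.state t p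
  enabled : ∀ t, E.proc t ∉ F → Enabled M 𝒯 (E.proc t) (E.state t (E.proc t)) (E.act t)
  next : ∀ t, E.proc t ∉ F →
    E.state (t + 1) (E.proc t) = (step 𝒯 sg (E.proc t) (E.state t (E.proc t)) (E.act t)).1
  send : ∀ t, E.proc t ∉ F → ∀ q,
    E.sent t q = (step 𝒯 sg (E.proc t) (E.state t (E.proc t)) (E.act t)).2
  /-- Correct processes only issue valid transactions of their own, with inputs from their local
  history, that do not conflict with transactions they issued before. -/
  client : ∀ t p tx, p ∉ F → E.Issues t p tx →
    𝒯.issuer tx = some p ∧ 𝒯.Valid tx ∧ (∀ x ∈ 𝒯.inputs tx, x ∈ (E.state t p).trHist) ∧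
      ∀ t' < t, ∀ tx', E.Issues t' p tx' → ¬ 𝒯.Conflict tx tx'
  /-- A message is received from `j` only if `j` sent it. -/
  receive_sent : ∀ t j m, E.proc t ∉ F → E.act t = .receive j m →
    ∃ t' < t, E.proc t' = j ∧ m ∈ E.sent t' (E.proc t)
  /-- Messages between correct processes eventually arrive. -/
  reliable : ∀ t q m, E.proc t ∉ F → q ∉ F → m ∈ E.sent t q →
    ∃ t' > t, E.proc t' = q ∧ E.act t' = .receive (E.proc t) m
  /-- A faulty process can only send those signatures of a correct process `r` that `r` created
  before. -/
  unforgeable : ∀ t q m, E.proc t ∈ F → m ∈ E.sent t q → ∀ e ∈ m.signed, ∀ r, r ∉ F →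
    sg.verify r e.1 e.2 = true → ∃ t' < t, E.Signs sg t' r e.1
  /-- Correct processes do not crash: an internal rule does not stay enabled forever without being
  executed. Here `collect`, `accept` and `accuse` are the internal rules. -/
  fair_collect : ∀ p, p ∉ F → ∀ tx t, ∃ t' ≥ t,
    ¬ Enabled M 𝒯 p (E.state t' p) (.collect tx) ∨ (E.proc t' = p ∧ E.act t' = .collect tx)
  fair_accept : ∀ p, p ∉ F → ∀ tx t, ∃ t' ≥ t,
    ¬ Enabled M 𝒯 p (E.state t' p) (.accept tx) ∨ (E.proc t' = p ∧ E.act t' = .accept tx)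
  fair_accuse : ∀ p, p ∉ F → ∀ j e e' t, ∃ t' ≥ t,
    ¬ Enabled M 𝒯 p (E.state t' p) (.accuse j e e') ∨
      (E.proc t' = p ∧ E.act t' = .accuse j e e')

def trace (E : Execution P Tx Sig) : Trace P Tx Sig where
  issued := E.Issues
  T := fun t p => (E.state t p).trHist
  A := fun t p => (E.state t p).acHist
  exhibited := {a | ∃ t q, Message.acc a ∈ E.sent t q}

end Execution

end SpendingAssetTransfer

/-! Safety rests on two facts. First, a correct process never echoes two conflicting transactions
(`not_conflict_of_echoes`): echoing marks the inputs as used, and a later echo needs unmarked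
inputs. Second, whatever a correct process accepts was echoed by all correct members of one of its
quorums (`quorum_of_mem_trHist`, `echoes_origin`), and since a process belongs to its own quorums,
by itself too.

For the spending bound, take all transactions that spend one output and choose for each a correct
process that accepted it. Distinct ones conflict, so the chosen processes are distinct. Selecting
for each the quorum behind its acceptance makes them independent in the trust graph, because a
common correct quorum member would have echoed two conflicting transactions.

Accusations are sound because a valid signature of a correct issuer, however often relayed, can be
traced back to an actual `transfer` (`issues_of_signed`), and correct clients never issue
conflicting transactions. They are effective because echoes carry the issuer's signature: two
conflicting requests held by one correct process become an accusation that is relayed to everyone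
(`exists_accusation`, `acHist_agreement`).

Liveness is a dichotomy (`accepts_or_accuses`). If a request reaches every correct process, either
all correct members of a fault-free quorum echo it and no rival blocks acceptance, or some correct
process holds a rival request and an accusation follows. Induction on acceptance times extends this
along the inputs. -/

namespace SpendingAssetTransfer

/-! ### Effects of a single protocol step on a local state -/

section Step

variable {P Tx Sig : Type*} {𝒯 : TxSystem P Tx}
  {sg : SigScheme P Tx Sig}

theorem mem_addAt {α : Type*} {arr : P → Set α} {j k : P} {s : Set α} {x : α} :
    x ∈ addAt arr j s k ↔ x ∈ arr k ∨ (k = j ∧ x ∈ s) := by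
  classical
  unfold addAt
  by_cases h : k = j
  · subst h; simp
  · simp [h]

/-- Local states only grow, except that pending transactions may move to the history. -/
structure LocalState.Le (st st' : LocalState P Tx Sig) : Prop where
  echoes : ∀ j, st.echoes j ⊆ st'.echoes j
  usedInp : ∀ j, st.usedInp j ⊆ st'.usedInp j
  signedRequests : ∀ j, st.signedRequests j ⊆ st'.signedRequests j
  trHist : st.trHist ⊆ st'.trHist
  acHist : st.acHist ⊆ st'.acHist
  pending : st.pending ⊆ st'.pending ∪ st'.trHist

theorem LocalState.Le.refl (st : LocalState P Tx Sig) : st.Le st :=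
  ⟨fun _ => subset_rfl, fun _ => subset_rfl, fun _ => subset_rfl, subset_rfl, subset_rfl,
    Set.subset_union_left⟩

theorem LocalState.Le.trans {a b c : LocalState P Tx Sig} (h : a.Le b) (h' : b.Le c) : a.Le c where
  echoes j := (h.echoes j).trans (h'.echoes j)
  usedInp j := (h.usedInp j).trans (h'.usedInp j)
  signedRequests j := (h.signedRequests j).trans (h'.signedRequests j)
  trHist := h.trHist.trans h'.trHist
  acHist := h.acHist.trans h'.acHist
  pending := fun _ hx => (h.pending hx).elim (fun hp => h'.pending hp)
    (fun ht => Or.inr (h'.trHist ht))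

theorem le_step (i : P) (st : LocalState P Tx Sig) (a : Action P Tx Sig) :
    st.Le (step 𝒯 sg i st a).1 := by
  rcases a with tx | ⟨j, (⟨tx, σ⟩ | ⟨tx, σs, σ⟩ | a)⟩ | tx | tx | ⟨j, e, e'⟩ | _ <;>
  simp only [step, onReq, onEcho, onAcc, echoIfFresh, storeAcc] <;>
  (repeat' split) <;> constructor <;> intros <;> intro x hx <;>
  simp_all [mem_addAt]
  all_goals tauto

theorem trHist_step (i : P) (st : LocalState P Tx Sig) (a : Action P Tx Sig) :
    (step 𝒯 sg i st a).1.trHist = st.trHist ∨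
      ∃ tx, a = .accept tx ∧ (step 𝒯 sg i st a).1.trHist = st.trHist ∪ {tx} := by
  rcases a with tx | ⟨j, (⟨tx, σ⟩ | ⟨tx, σs, σ⟩ | a)⟩ | tx | tx | ⟨j, e, e'⟩ | _
  case accept => exact Or.inr ⟨tx, rfl, rfl⟩
  all_goals
    left
    simp only [step, onReq, onEcho, onAcc, echoIfFresh, storeAcc]
    try repeat' split
    all_goals rfl

theorem mem_trHist_step {i : P} {st : LocalState P Tx Sig} {a : Action P Tx Sig} {tx : Tx}
    (h : tx ∈ (step 𝒯 sg i st a).1.trHist) : tx ∈ st.trHist ∨ a = .accept tx := by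
  rcases trHist_step (𝒯 := 𝒯) (sg := sg) i st a with h' | ⟨tx', rfl, h'⟩ <;> rw [h'] at h
  · exact Or.inl h
  · exact h.imp_right fun h => by rw [Set.mem_singleton_iff.1 h]

theorem mem_pending_step {i : P} {st : LocalState P Tx Sig} {a : Action P Tx Sig} {tx : Tx}
    (h : tx ∈ (step 𝒯 sg i st a).1.pending) : tx ∈ st.pending ∨ a = .collect tx := by
  rcases a with tx | ⟨j, (⟨tx, σ⟩ | ⟨tx, σs, σ⟩ | a)⟩ | tx | tx | ⟨j, e, e'⟩ | _ <;>
  simp only [step, onReq, onEcho, onAcc, echoIfFresh, storeAcc] at h <;>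
  (repeat' split at h) <;> simp_all
  tauto

theorem mem_echoes_step {i j : P} {st : LocalState P Tx Sig} {a : Action P Tx Sig} {tx : Tx}
    (h : tx ∈ (step 𝒯 sg i st a).1.echoes j) :
    tx ∈ st.echoes j ∨ ∃ σs σ, a = .receive j (.echo tx σs σ) := by
  rcases a with tx | ⟨j, (⟨tx, σ⟩ | ⟨tx, σs, σ⟩ | a)⟩ | tx | tx | ⟨j, e, e'⟩ | _ <;>
  simp only [step, onReq, onEcho, onAcc, echoIfFresh, storeAcc] at h <;>
  (repeat' split at h) <;> simp_all [mem_addAt] <;> tauto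

/-- Every rule that stores an accusation goes through `storeAcc`, which also broadcasts it;
agreement depends on this. -/
theorem mem_acHist_step {i : P} {st : LocalState P Tx Sig} {a : Action P Tx Sig}
    {b : Accusation P Tx Sig} (h : b ∈ (step 𝒯 sg i st a).1.acHist) :
    b ∈ st.acHist ∨ .acc b ∈ (step 𝒯 sg i st a).2 := by
  rcases a with tx | ⟨j, (⟨tx, σ⟩ | ⟨tx, σs, σ⟩ | a)⟩ | tx | tx | ⟨j, e, e'⟩ | _ <;>
  simp only [step, onReq, onEcho, onAcc, echoIfFresh, storeAcc] at h ⊢ <;>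
  (repeat' split at h) <;> simp_all <;> tauto

theorem acc_mem_step {i : P} {st : LocalState P Tx Sig} {a : Action P Tx Sig}
    {b : Accusation P Tx Sig} (h : .acc b ∈ (step 𝒯 sg i st a).2) :
    (VerifyAcc 𝒯 sg b ∧ ∃ j, a = .receive j (.acc b)) ∨
      ∃ j e e', a = .accuse j e e' ∧ b = mkAcc j e e' := by
  rcases a with tx | ⟨j, (⟨tx, σ⟩ | ⟨tx, σs, σ⟩ | a)⟩ | tx | tx | ⟨j, e, e'⟩ | _ <;>
  simp only [step, onReq, onEcho, onAcc, echoIfFresh, storeAcc] at h ⊢ <;>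
  (repeat' split at h) <;> simp_all
  exact ⟨_, _, _, _, ⟨rfl, rfl⟩, rfl⟩

theorem req_mem_step {i : P} {st : LocalState P Tx Sig} {a : Action P Tx Sig} {tx : Tx} {σ : Sig}
    (h : .req tx σ ∈ (step 𝒯 sg i st a).2) : a = .transfer tx := by
  rcases a with tx | ⟨j, (⟨tx, σ⟩ | ⟨tx, σs, σ⟩ | a)⟩ | tx | tx | ⟨j, e, e'⟩ | _ <;>
  simp only [step, onReq, onEcho, onAcc, echoIfFresh, storeAcc] at h ⊢ <;>
  (repeat' split at h) <;> simp_all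

/-- The step `a` hands the request `e` of the issuer `s`, with a valid signature, to a process. -/
def Delivers (𝒯 : TxSystem P Tx) (sg : SigScheme P Tx Sig) (a : Action P Tx Sig) (s : P)
    (e : Tx × Sig) : Prop :=
  𝒯.issuer e.1 = some s ∧ sg.verify s e.1 e.2 = true ∧
    (a = .receive s (.req e.1 e.2) ∨ ∃ j σ, a = .receive j (.echo e.1 e.2 σ))

/-- Storing and echoing belong to the same handler, so a newly stored request that is not echoed at
once must have been blocked by an input already marked as used. This is the source of the dichotomy
in `echoes_or_conflict`. -/
theorem mem_signedRequests_step {i s : P} {st : LocalState P Tx Sig} {a : Action P Tx Sig}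
    {e : Tx × Sig} (h : e ∈ (step 𝒯 sg i st a).1.signedRequests s) :
    e ∈ st.signedRequests s ∨ Delivers 𝒯 sg a s e ∧
      (.echo e.1 e.2 (sg.sign i e.1) ∈ (step 𝒯 sg i st a).2 ∨
        ∃ x ∈ 𝒯.inputs e.1, x ∈ st.usedInp s) := by
  obtain ⟨tx0, σ0⟩ := e
  rcases a with tx | ⟨j, (⟨tx, σ⟩ | ⟨tx, σs, σ⟩ | a)⟩ | tx | tx | ⟨j, e, e'⟩ | _ <;>
  simp only [step, onReq, onEcho, onAcc, echoIfFresh, storeAcc] at h ⊢ <;>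
  (repeat' split at h) <;> simp_all [mem_addAt, Delivers] <;> grind

theorem mem_usedInp_step {i s : P} {st : LocalState P Tx Sig} {a : Action P Tx Sig} {x : Tx}
    (h : x ∈ (step 𝒯 sg i st a).1.usedInp s) :
    x ∈ st.usedInp s ∨ ∃ tx σs, .echo tx σs (sg.sign i tx) ∈ (step 𝒯 sg i st a).2 ∧
      x ∈ 𝒯.inputs tx ∧ 𝒯.issuer tx = some s := by
  rcases a with tx | ⟨j, (⟨tx, σ⟩ | ⟨tx, σs, σ⟩ | a)⟩ | tx | tx | ⟨j, e, e'⟩ | _ <;>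
  simp only [step, onReq, onEcho, onAcc, echoIfFresh, storeAcc] at h ⊢ <;>
  (repeat' split at h) <;> simp_all [mem_addAt] <;> grind

theorem echo_mem_step {i : P} {st : LocalState P Tx Sig} {a : Action P Tx Sig} {tx : Tx}
    {σs σ : Sig} (h : .echo tx σs σ ∈ (step 𝒯 sg i st a).2) :
    σ = sg.sign i tx ∧ ∃ s, Delivers 𝒯 sg a s (tx, σs) ∧
      (∀ x ∈ 𝒯.inputs tx, x ∉ st.usedInp s) ∧
      (∀ x ∈ 𝒯.inputs tx, x ∈ (step 𝒯 sg i st a).1.usedInp s) ∧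
      (tx, σs) ∈ (step 𝒯 sg i st a).1.signedRequests s := by
  rcases a with tx | ⟨j, (⟨tx, σ⟩ | ⟨tx, σs, σ⟩ | a)⟩ | tx | tx | ⟨j, e, e'⟩ | _ <;>
  simp only [step, onReq, onEcho, onAcc, echoIfFresh, storeAcc] at h ⊢ <;>
  (repeat' split at h) <;> simp_all [mem_addAt, Delivers]

theorem receive_req_step {i j : P} {st : LocalState P Tx Sig} {tx : Tx} {σ : Sig}
    (hs : 𝒯.issuer tx = some j) (hv : sg.verify j tx σ = true) :
    (tx, σ) ∈ (step 𝒯 sg i st (.receive j (.req tx σ))).1.signedRequests j := by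
  simp only [step, onReq, echoIfFresh]
  (repeat' split) <;> simp_all [mem_addAt]

theorem receive_echo_step {i j s : P} {st : LocalState P Tx Sig} {tx : Tx} {σs σ : Sig}
    (hs : 𝒯.issuer tx = some s) (hv : sg.verify j tx σ = true) (hvs : sg.verify s tx σs = true) :
    tx ∈ (step 𝒯 sg i st (.receive j (.echo tx σs σ))).1.echoes j ∧
      (tx, σs) ∈ (step 𝒯 sg i st (.receive j (.echo tx σs σ))).1.signedRequests s := by
  simp only [step, onEcho, echoIfFresh, hs, hv, hvs]
  (repeat' split) <;> simp_all [mem_addAt]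

theorem receive_acc_step {i j : P} {st : LocalState P Tx Sig} {a : Accusation P Tx Sig}
    (hv : VerifyAcc 𝒯 sg a) : a ∈ (step 𝒯 sg i st (.receive j (.acc a))).1.acHist := by
  simp only [step, onAcc, storeAcc]
  split <;> simp_all

end Step

/-! ### Dependencies and two-element accusations -/

section Transactions

variable {P Tx Sig : Type*} {𝒯 : TxSystem P Tx} {sg : SigScheme P Tx Sig}

theorem TxSystem.Conflict.symm {tx tx' : Tx} (h : 𝒯.Conflict tx tx') : 𝒯.Conflict tx' tx :=
  ⟨h.1.symm, h.2.1.symm, h.2.2.imp fun _ hx => hx.symm⟩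

/-- A set closed under inputs contains everything that its members depend on. -/
theorem TxSystem.mem_of_dependsOn {T : Set Tx} (hT : ∀ tx ∈ T, ∀ x ∈ 𝒯.inputs tx, x ∈ T)
    {tx tx' : Tx} (h : 𝒯.DependsOn tx tx') (htx : tx ∈ T) : tx' ∈ T := by
  induction h using Relation.TransGen.head_induction_on with
  | single h => exact hT _ htx _ h
  | head h _ ih => exact hT _ ih _ h

/-- Evidence is symmetric in the two signed transactions, so a single accusation refers to both of
them. -/
theorem refersTo_mkAcc {j : P} {e e' : Tx × Sig} (h : IsEvidence 𝒯 sg j e e') :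
    VerifyAcc 𝒯 sg (mkAcc j e e') ∧ RefersTo 𝒯 sg (mkAcc j e e') e.1 ∧
      RefersTo 𝒯 sg (mkAcc j e e') e'.1 := by
  have h' : IsEvidence 𝒯 sg j e' e := ⟨h.2.1.2.1 ▸ h.1, h.2.1.symm, h.2.2.2, h.2.2.1⟩
  refine ⟨fun p hp => ⟨e, by simp [mkAcc], e', by simp [mkAcc], ?_⟩,
    ⟨j, by simp [mkAcc], e, by simp [mkAcc], e', by simp [mkAcc], rfl, h⟩,
    ⟨j, by simp [mkAcc], e', by simp [mkAcc], e, by simp [mkAcc], rfl, h'⟩⟩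
  obtain rfl : p = j := by simpa [mkAcc] using hp
  exact h

end Transactions

end SpendingAssetTransfer

namespace SpendingAssetTransfer

/-! ### Tracing signatures and accusations through an execution -/

namespace Execution.Admissible

variable {P Tx Sig : Type*} [Fintype P] {M : TrustModel P} {𝒯 : TxSystem P Tx}
  {sg : SigScheme P Tx Sig} {F : Set P} {E : Execution P Tx Sig}

theorem state_succ (hE : E.Admissible M 𝒯 sg F) {p : P} (hp : p ∉ F) (t : ℕ) :
    E.state (t + 1) p = E.state t p ∨ E.proc t = p ∧
      E.state (t + 1) p = (step 𝒯 sg p (E.state t p) (E.act t)).1 := by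
  by_cases h : p = E.proc t
  · subst h
    exact Or.inr ⟨rfl, hE.next t hp⟩
  · exact Or.inl (hE.frame t p hp h)

theorem state_le (hE : E.Admissible M 𝒯 sg F) {p : P} (hp : p ∉ F) {t t' : ℕ} (h : t ≤ t') :
    (E.state t p).Le (E.state t' p) := by
  induction t', h using Nat.le_induction with
  | base => exact .refl _
  | succ n _ ih =>
    rcases hE.state_succ hp n with h | ⟨_, h⟩
    · rwa [h]
    · rw [h]
      exact ih.trans (le_step _ _ _)

/-- Whatever holds in a local state was initially true or became true in an earlier step. -/
theorem exists_step (hE : E.Admissible M 𝒯 sg F) {p : P} (hp : p ∉ F)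
    (Φ : LocalState P Tx Sig → Prop) {t : ℕ} (h : Φ (E.state t p)) :
    Φ (initialState 𝒯) ∨ ∃ u < t, E.proc u = p ∧ ¬ Φ (E.state u p) ∧
      Φ (step 𝒯 sg p (E.state u p) (E.act u)).1 := by
  induction t with
  | zero => exact Or.inl (hE.init p hp ▸ h)
  | succ n ih =>
    by_cases hn : Φ (E.state n p)
    · exact (ih hn).imp_right fun ⟨u, hu, h'⟩ => ⟨u, by omega, h'⟩
    · rcases hE.state_succ hp n with h' | ⟨hpn, h'⟩
      · rw [h'] at h
        exact absurd h hn
      · rw [h'] at h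
        exact Or.inr ⟨n, by omega, hpn, hn, h⟩

theorem mem_sent (hE : E.Admissible M 𝒯 sg F) {p : P} (hp : p ∉ F) {t : ℕ} (ht : E.proc t = p)
    {m : Message P Tx Sig} (q : P) :
    m ∈ E.sent t q ↔ m ∈ (step 𝒯 sg p (E.state t p) (E.act t)).2 := by
  subst ht
  rw [hE.send t hp q]

/-- A delivered request was carried by a message sent earlier. -/
theorem sent_of_delivers (hE : E.Admissible M 𝒯 sg F) {t : ℕ} (ht : E.proc t ∉ F) {s : P}
    {e : Tx × Sig} (h : Delivers 𝒯 sg (E.act t) s e) :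
    ∃ u < t, ∃ m ∈ E.sent u (E.proc t), e ∈ m.signed := by
  rcases h.2.2 with h | ⟨j, σ, h⟩ <;> obtain ⟨u, hu, -, hm⟩ := hE.receive_sent t _ _ ht h
  · exact ⟨u, hu, _, hm, by simp [Message.signed]⟩
  · exact ⟨u, hu, _, hm, by simp [Message.signed]⟩

theorem signedRequests_origin (hE : E.Admissible M 𝒯 sg F) {p : P} (hp : p ∉ F) {t : ℕ} {s : P}
    {e : Tx × Sig} (h : e ∈ (E.state t p).signedRequests s) :
    ∃ u < t, E.proc u = p ∧ Delivers 𝒯 sg (E.act u) s e ∧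
      (.echo e.1 e.2 (sg.sign p e.1) ∈ (step 𝒯 sg p (E.state u p) (E.act u)).2 ∨
        ∃ x ∈ 𝒯.inputs e.1, x ∈ (E.state u p).usedInp s) := by
  rcases hE.exists_step hp (fun st => e ∈ st.signedRequests s) h with h | ⟨u, hu, hpu, hn, h⟩
  · simp [initialState] at h
  · rcases mem_signedRequests_step h with h | h
    · exact absurd h hn
    · exact ⟨u, hu, hpu, h⟩

/-- A validly signed transaction of a correct process in any message was issued by it. -/
theorem issues_of_signed (hE : E.Admissible M 𝒯 sg F) {r : P} (hr : r ∉ F) {t : ℕ} {q : P}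
    {m : Message P Tx Sig} (hm : m ∈ E.sent t q) {e : Tx × Sig} (he : e ∈ m.signed)
    (hi : 𝒯.issuer e.1 = some r) (hv : sg.verify r e.1 e.2 = true) :
    ∃ u ≤ t, E.Issues u r e.1 := by
  induction t using Nat.strong_induction_on generalizing q m e with
  | _ t ih =>
    -- The induction is on sending time. Only the transaction has to persist: the earlier message
    -- may carry a different valid signature of `r`.
    have sent_before : (∃ u < t, ∃ m' ∈ E.sent u (E.proc t), ∃ e' ∈ m'.signed, e'.1 = e.1 ∧
        sg.verify r e'.1 e'.2 = true) → ∃ u ≤ t, E.Issues u r e.1 := by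
      rintro ⟨u, hu, m', hm', e', he', h1, hv'⟩
      obtain ⟨w, hw, hiss⟩ := ih u hu hm' he' (h1 ▸ hi) hv'
      exact ⟨w, by omega, h1 ▸ hiss⟩
    by_cases hp : E.proc t ∈ F
    -- A faulty sender must copy a signature that `r` created earlier, and the message in which `r`
    -- created it falls under the induction hypothesis.
    · obtain ⟨u, hu, hpu, q', h⟩ := hE.unforgeable t q m hp hm e he r hr hv
      rcases h with h | ⟨σs, h⟩
      · obtain ⟨w, hw, hiss⟩ := ih u hu h (e := (e.1, sg.sign r e.1)) (by simp [Message.signed]) hi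
          (sg.verify_sign _ _)
        exact ⟨w, by omega, hiss⟩
      · obtain ⟨w, hw, hiss⟩ := ih u hu h (e := (e.1, sg.sign r e.1)) (by simp [Message.signed]) hi
          (sg.verify_sign _ _)
        exact ⟨w, by omega, hiss⟩
    · have hm' := (hE.mem_sent hp rfl q).1 hm
      rcases m with ⟨tx, σ⟩ | ⟨tx, σs, σ⟩ | a
      · obtain rfl : e = (tx, σ) := he
        have hiss : E.Issues t (E.proc t) tx := ⟨rfl, req_mem_step hm'⟩
        have := (hE.client t _ tx hp hiss).1
        obtain rfl : r = E.proc t := by simpa [hi] using this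
        exact ⟨t, le_rfl, hiss⟩
      -- The pair `e` may hold the echoer's own signature rather than the issuer's. Both belong to
      -- `tx`, so the verified issuer signature in the delivered request takes over.
      · have h1 : e.1 = tx := by
          rcases he with rfl | rfl <;> rfl
        obtain ⟨-, s, hd, -⟩ := echo_mem_step hm'
        obtain rfl : s = r := by
          have := hd.1
          simp only [← h1, hi] at this
          exact (Option.some.inj this).symm
        obtain ⟨u, hu, m', hm'', he'⟩ := hE.sent_of_delivers hp hd
        exact sent_before ⟨u, hu, m', hm'', _, he', h1.symm, hd.2.1⟩
      · rcases acc_mem_step hm' with ⟨-, j, h⟩ | ⟨j, e1, e2, h, rfl⟩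
        · obtain ⟨u, hu, -, h⟩ := hE.receive_sent t _ _ hp h
          exact sent_before ⟨u, hu, _, h, e, he, rfl, hv⟩
        · have hen := hE.enabled t hp
          rw [h] at hen
          have hmem : e ∈ (E.state t (E.proc t)).signedRequests j := by
            have he : e = e1 ∨ e = e2 := by simpa [Message.signed, mkAcc] using he
            rcases he with rfl | rfl
            · exact hen.1
            · exact hen.2.1
          obtain ⟨u, hu, hpu, hd, -⟩ := hE.signedRequests_origin hp hmem
          obtain ⟨w, hw, m', hm'', he'⟩ := hE.sent_of_delivers (hpu ▸ hp) hd
          exact sent_before ⟨w, hw.trans hu, m', hpu ▸ hm'', e, he', rfl, hv⟩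

/-- The client assumption only compares with strictly earlier issues; within one step the action
determines the transaction. -/
theorem not_conflict_of_issues (hE : E.Admissible M 𝒯 sg F) {r : P} (hr : r ∉ F) {t t' : ℕ}
    {tx tx' : Tx} (h : E.Issues t r tx) (h' : E.Issues t' r tx') : ¬ 𝒯.Conflict tx tx' := by
  intro hc
  rcases lt_trichotomy t t' with hlt | rfl | hlt
  · exact (hE.client t' r tx' hr h').2.2.2 t hlt tx h hc.symm
  · have := h.2.symm.trans h'.2
    exact hc.1 (by simpa using this)
  · exact (hE.client t r tx hr h).2.2.2 t' hlt tx' h' hc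

/-- If an accused process were correct, it would have issued both conflicting transactions of its
evidence. The sender may be faulty, so this serves both accuracy claims. -/
theorem subset_faulty_of_sent (hE : E.Admissible M 𝒯 sg F) {a : Accusation P Tx Sig} {t : ℕ}
    {q : P} (h : .acc a ∈ E.sent t q) (hv : VerifyAcc 𝒯 sg a) : (a.AC : Set P) ⊆ F := by
  intro r hr
  by_contra hrF
  obtain ⟨e, he, e', he', hi, hc, hve, hve'⟩ := hv r hr
  obtain ⟨u, -, hu⟩ := hE.issues_of_signed hrF h he hi hve
  obtain ⟨u', -, hu'⟩ := hE.issues_of_signed hrF h he' (hc.2.1 ▸ hi) hve'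
  exact hE.not_conflict_of_issues hrF hu hu' hc

theorem issuer_of_mem_signedRequests (hE : E.Admissible M 𝒯 sg F) {p : P} (hp : p ∉ F) {t : ℕ}
    {s : P} {e : Tx × Sig} (h : e ∈ (E.state t p).signedRequests s) :
    𝒯.issuer e.1 = some s ∧ sg.verify s e.1 e.2 = true := by
  obtain ⟨u, -, -, hd, -⟩ := hE.signedRequests_origin hp h
  exact ⟨hd.1, hd.2.1⟩

theorem isEvidence_of_mem (hE : E.Admissible M 𝒯 sg F) {p : P} (hp : p ∉ F) {t : ℕ}
    {s : P} {e e' : Tx × Sig} (h : e ∈ (E.state t p).signedRequests s)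
    (h' : e' ∈ (E.state t p).signedRequests s) (hne : e.1 ≠ e'.1)
    (hx : ∃ x, x ∈ 𝒯.inputs e.1 ∧ x ∈ 𝒯.inputs e'.1) : IsEvidence 𝒯 sg s e e' := by
  obtain ⟨hi, hv⟩ := hE.issuer_of_mem_signedRequests hp h
  obtain ⟨hi', hv'⟩ := hE.issuer_of_mem_signedRequests hp h'
  exact ⟨hi, ⟨hne, hi.trans hi'.symm, hx⟩, hv, hv'⟩

/-- A stored accusation was verified, and has been sent to everybody. -/
theorem acHist_origin (hE : E.Admissible M 𝒯 sg F) {p : P} (hp : p ∉ F) {t : ℕ}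
    {a : Accusation P Tx Sig} (h : a ∈ (E.state t p).acHist) :
    VerifyAcc 𝒯 sg a ∧ ∃ u < t, E.proc u = p ∧ ∀ q, .acc a ∈ E.sent u q := by
  rcases hE.exists_step hp (fun st => a ∈ st.acHist) h with h | ⟨u, hu, hpu, hn, h⟩
  · simp [initialState] at h
  · rcases mem_acHist_step h with h | h
    · exact absurd h hn
    refine ⟨?_, u, hu, hpu, fun q => (hE.mem_sent hp hpu q).2 h⟩
    rcases acc_mem_step h with ⟨hv, -⟩ | ⟨j, e, e', ha, rfl⟩
    · exact hv
    · subst hpu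
      have hen := hE.enabled u hp
      rw [ha] at hen
      exact (refersTo_mkAcc (hE.isEvidence_of_mem hp hen.1 hen.2.1 hen.2.2.1 hen.2.2.2.1)).1

theorem receives (hE : E.Admissible M 𝒯 sg F) {p q : P} (hp : p ∉ F) (hq : q ∉ F) {t : ℕ}
    (ht : E.proc t = p) {m : Message P Tx Sig} (hm : m ∈ E.sent t q) :
    ∃ u, E.state (u + 1) q = (step 𝒯 sg q (E.state u q) (.receive p m)).1 := by
  subst ht
  obtain ⟨u, -, rfl, h⟩ := hE.reliable t q m hp hq hm
  exact ⟨u, by rw [hE.next u hq, h]⟩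

/-- The broadcast made when the accusation was stored reaches `q`, and verification does not depend
on the state of the verifier. -/
theorem acHist_agreement (hE : E.Admissible M 𝒯 sg F) {p q : P} (hp : p ∉ F) (hq : q ∉ F) {t : ℕ}
    {a : Accusation P Tx Sig} (h : a ∈ (E.state t p).acHist) :
    ∃ u, a ∈ (E.state u q).acHist := by
  obtain ⟨hv, u, -, hpu, hs⟩ := hE.acHist_origin hp h
  obtain ⟨w, hw⟩ := hE.receives hp hq hpu (hs q)
  exact ⟨w + 1, hw ▸ receive_acc_step hv⟩

/-- Two conflicting signed requests held by a correct process get everybody to accuse. -/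
theorem exists_accusation (hE : E.Admissible M 𝒯 sg F) {c q : P} (hc : c ∉ F) (hq : q ∉ F)
    {t t' : ℕ} {s : P} {e e' : Tx × Sig} (h : e ∈ (E.state t c).signedRequests s)
    (h' : e' ∈ (E.state t' c).signedRequests s) (hne : e.1 ≠ e'.1)
    (hx : ∃ x, x ∈ 𝒯.inputs e.1 ∧ x ∈ 𝒯.inputs e'.1) :
    ∃ u, ∃ a ∈ (E.state u q).acHist, RefersTo 𝒯 sg a e.1 ∧ RefersTo 𝒯 sg a e'.1 := by
  have hw : ∀ w, max t t' ≤ w →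
      e ∈ (E.state w c).signedRequests s ∧ e' ∈ (E.state w c).signedRequests s := fun w hw =>
    ⟨(hE.state_le hc (le_trans (le_max_left _ _) hw)).signedRequests s h,
      (hE.state_le hc (le_trans (le_max_right _ _) hw)).signedRequests s h'⟩
  have hacc : ∃ w, mkAcc s e e' ∈ (E.state w c).acHist := by
    obtain ⟨w, hge, hfair⟩ := hE.fair_accuse c hc s e e' (max t t')
    -- Both requests stay stored, so the rule can be disabled only because the accusation is already
    -- in the history.
    rcases hfair with hne' | ⟨rfl, hact⟩
    · by_contra hcon
      exact hne' ⟨(hw w hge).1, (hw w hge).2, hne, hx, fun h => hcon ⟨w, h⟩⟩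
    · refine ⟨w + 1, ?_⟩
      rw [hE.next w hc, hact]
      simp [step, storeAcc]
  obtain ⟨w, hacc⟩ := hacc
  obtain ⟨u, hu⟩ := hE.acHist_agreement hc hq hacc
  have hev := hE.isEvidence_of_mem hc (hw _ le_rfl).1 (hw _ le_rfl).2 hne hx
  exact ⟨u, _, hu, (refersTo_mkAcc hev).2⟩

/-! ### Echoes, their consistency, and the origin of accepted transactions -/

/-- `p` has sent an echo for `tx`, carrying the signed request `(tx, σs)`, in step `t`. -/
def Echoes (E : Execution P Tx Sig) (sg : SigScheme P Tx Sig) (t : ℕ) (p : P) (tx : Tx)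
    (σs : Sig) : Prop :=
  E.proc t = p ∧ ∀ q, .echo tx σs (sg.sign p tx) ∈ E.sent t q

theorem echoes_of_sent (hE : E.Admissible M 𝒯 sg F) {p : P} (hp : p ∉ F) {t : ℕ}
    (ht : E.proc t = p) {tx : Tx} {σs σ : Sig} {q : P} (h : .echo tx σs σ ∈ E.sent t q) :
    Echoes E sg t p tx σs ∧ ∃ s, Delivers 𝒯 sg (E.act t) s (tx, σs) ∧
      (∀ x ∈ 𝒯.inputs tx, x ∉ (E.state t p).usedInp s) ∧
      (∀ x ∈ 𝒯.inputs tx, x ∈ (E.state (t + 1) p).usedInp s) ∧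
      (tx, σs) ∈ (E.state (t + 1) p).signedRequests s := by
  have h' := (hE.mem_sent hp ht q).1 h
  obtain ⟨rfl, h1⟩ := echo_mem_step h'
  refine ⟨⟨ht, fun q' => (hE.mem_sent hp ht q').2 h'⟩, ?_⟩
  subst ht
  rwa [hE.next t hp]

/-- Correct processes do not echo conflicting transactions. -/
theorem not_conflict_of_echoes (hE : E.Admissible M 𝒯 sg F) {p : P} (hp : p ∉ F) {t t' : ℕ}
    {tx tx' : Tx} {σ σ' : Sig} (h : Echoes E sg t p tx σ) (h' : Echoes E sg t' p tx' σ') :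
    ¬ 𝒯.Conflict tx tx' := by
  have key : ∀ {t t' tx tx' σ σ'}, Echoes E sg t p tx σ → Echoes E sg t' p tx' σ' → t < t' →
      ¬ 𝒯.Conflict tx tx' := by
    rintro t t' tx tx' σ σ' h h' hlt ⟨-, hi, x, hx, hx'⟩
    obtain ⟨-, s, hd, -, hin, -⟩ := hE.echoes_of_sent hp h.1 (h.2 p)
    obtain ⟨-, s', hd', hout, -, -⟩ := hE.echoes_of_sent hp h'.1 (h'.2 p)
    obtain rfl : s = s' := Option.some.inj (hd.1.symm.trans (hi.trans hd'.1))
    -- The earlier echo has marked the shared input by time `t + 1 ≤ t'`, but the later one needs it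
    -- unmarked at `t'`.
    exact hout x hx' ((hE.state_le hp hlt).usedInp s (hin x hx))
  intro hc
  rcases lt_trichotomy t t' with hlt | rfl | hlt
  · exact key h h' hlt hc
  · have h1 := (hE.mem_sent hp h.1 p).1 (h.2 p)
    have h2 := (hE.mem_sent hp h.1 p).1 (h'.2 p)
    obtain ⟨-, s, hd, -⟩ := echo_mem_step h1
    obtain ⟨-, s', hd', -⟩ := echo_mem_step h2
    -- A step has one action, which delivers one transaction, so two echoes of the same step agree.
    rcases hd.2.2 with ha | ⟨j, σ1, ha⟩ <;> rcases hd'.2.2 with hb | ⟨j', σ2, hb⟩ <;>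
      rw [ha] at hb <;> simp only [Action.receive.injEq, Message.req.injEq, Message.echo.injEq,
        reduceCtorEq, and_false] at hb
    · exact hc.1 hb.2.1
    · exact hc.1 hb.2.1
  · exact key h' h hlt hc.symm

theorem usedInp_origin (hE : E.Admissible M 𝒯 sg F) {p : P} (hp : p ∉ F) {t : ℕ} {s : P} {x : Tx}
    (h : x ∈ (E.state t p).usedInp s) :
    ∃ u, ∃ tx σs, Echoes E sg u p tx σs ∧ x ∈ 𝒯.inputs tx ∧ 𝒯.issuer tx = some s := by
  rcases hE.exists_step hp (fun st => x ∈ st.usedInp s) h with h | ⟨u, hu, hpu, hn, h⟩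
  · simp [initialState] at h
  · rcases mem_usedInp_step h with h | ⟨tx, σs, h, hx, hi⟩
    · exact absurd h hn
    · exact ⟨u, tx, σs, ⟨hpu, fun q => (hE.mem_sent hp hpu q).2 h⟩, hx, hi⟩

/-- A correct process that holds a request has echoed it, or holds a conflicting one. -/
theorem echoes_or_conflict (hE : E.Admissible M 𝒯 sg F) {p : P} (hp : p ∉ F) {t : ℕ} {s : P}
    {tx : Tx} {σs : Sig} (h : (tx, σs) ∈ (E.state t p).signedRequests s) :
    (∃ u σ, Echoes E sg u p tx σ) ∨ ∃ u, ∃ e ∈ (E.state u p).signedRequests s, tx ≠ e.1 ∧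
      ∃ x, x ∈ 𝒯.inputs tx ∧ x ∈ 𝒯.inputs e.1 := by
  obtain ⟨u, -, hpu, hd, h | ⟨x, hx, hused⟩⟩ := hE.signedRequests_origin hp h
  · exact Or.inl ⟨u, σs, hpu, fun q => (hE.mem_sent hp hpu q).2 h⟩
  · obtain ⟨w, tx', σ', he, hx', hi'⟩ := hE.usedInp_origin hp hused
    -- The input may have been marked by an echo of `tx` itself under another signature of the
    -- issuer; this is why the first alternative leaves the signature free.
    by_cases heq : tx = tx'
    · exact Or.inl ⟨w, σ', heq ▸ he⟩
    · obtain ⟨-, s', hd', -, -, hmem⟩ := hE.echoes_of_sent hp he.1 (he.2 p)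
      obtain rfl : s' = s := Option.some.inj (hd'.1.symm.trans hi')
      exact Or.inr ⟨w + 1, _, hmem, heq, x, hx, hx'⟩

/-- An echo of a correct process reaches every correct process. -/
theorem echoes_received (hE : E.Admissible M 𝒯 sg F) {c q : P} (hc : c ∉ F) (hq : q ∉ F) {t : ℕ}
    {tx : Tx} {σs : Sig} (h : Echoes E sg t c tx σs) :
    ∃ u s, tx ∈ (E.state u q).echoes c ∧ (tx, σs) ∈ (E.state u q).signedRequests s := by
  obtain ⟨-, s, hd, -⟩ := hE.echoes_of_sent hc h.1 (h.2 q)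
  obtain ⟨u, hu⟩ := hE.receives hc hq h.1 (h.2 q)
  exact ⟨u + 1, s, by rw [hu]; exact receive_echo_step hd.1 (sg.verify_sign _ _) hd.2.1⟩

theorem echoes_origin (hE : E.Admissible M 𝒯 sg F) {p q : P} (hp : p ∉ F) (hq : q ∉ F) {t : ℕ}
    {tx : Tx} (h : tx ∈ (E.state t p).echoes q) : ∃ u < t, ∃ σs, Echoes E sg u q tx σs := by
  rcases hE.exists_step hp (fun st => tx ∈ st.echoes q) h with h | ⟨u, hu, hpu, hn, h⟩
  · simp [initialState] at h
  · rcases mem_echoes_step h with h | ⟨σs, σ, ha⟩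
    · exact absurd h hn
    · subst hpu
      obtain ⟨w, hw, hq', hm⟩ := hE.receive_sent u _ _ hp ha
      exact ⟨w, by omega, σs, (hE.echoes_of_sent hq hq' hm).1⟩

theorem trHist_origin (hE : E.Admissible M 𝒯 sg F) {p : P} (hp : p ∉ F) {t : ℕ} {tx : Tx}
    (h : tx ∈ (E.state t p).trHist) : tx = 𝒯.init ∨ ∃ u < t,
      tx ∈ (E.state u p).pending ∧ Ready 𝒯 (E.state u p) tx := by
  rcases hE.exists_step hp (fun st => tx ∈ st.trHist) h with h | ⟨u, hu, hpu, hn, h⟩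
  · exact Or.inl h
  · rcases mem_trHist_step h with h | ha
    · exact absurd h hn
    · subst hpu
      have hen := hE.enabled u hp
      rw [ha] at hen
      exact Or.inr ⟨u, hu, hen⟩

/-- An accepted transaction has been echoed by a quorum. -/
theorem quorum_of_mem_trHist (hE : E.Admissible M 𝒯 sg F) {p : P} (hp : p ∉ F) {t : ℕ} {tx : Tx}
    (h : tx ∈ (E.state t p).trHist) : tx = 𝒯.init ∨ ∃ u < t, ∃ Q ∈ M.quorums p,
      ∀ q ∈ Q, tx ∈ (E.state u p).echoes q := by
  obtain h | ⟨u, hu, hpend, -⟩ := hE.trHist_origin hp h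
  · exact Or.inl h
  · rcases hE.exists_step hp (fun st => tx ∈ st.pending) hpend with h | ⟨w, hw, hpw, hn, h⟩
    · simp [initialState] at h
    · rcases mem_pending_step h with h | ha
      · exact absurd h hn
      · subst hpw
        have hen := hE.enabled w hp
        rw [ha] at hen
        exact Or.inr ⟨w, by omega, hen.1⟩

/-- A correct process echoes whatever it accepts. -/
theorem echoes_of_mem_trHist (hE : E.Admissible M 𝒯 sg F) {p : P} (hp : p ∉ F) {t : ℕ} {tx : Tx}
    (h : tx ∈ (E.state t p).trHist) : tx = 𝒯.init ∨ ∃ u < t, ∃ σs, Echoes E sg u p tx σs := by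
  obtain h | ⟨u, hu, Q, hQ, hq⟩ := hE.quorum_of_mem_trHist hp h
  · exact Or.inl h
  · obtain ⟨w, hw, h⟩ := hE.echoes_origin hp hp (hq p (M.self_mem p Q hQ))
    exact Or.inr ⟨w, by omega, h⟩

/-- The echo that `p` itself sent before accepting carries a verified signature of `r`, which is
traced back to an issue. -/
theorem integrity (hE : E.Admissible M 𝒯 sg F) {p r : P} (hp : p ∉ F) (hr : r ∉ F) {t : ℕ}
    {tx : Tx} (h : tx ∈ (E.state t p).trHist) (hi : 𝒯.issuer tx = some r) :
    ∃ u < t, E.Issues u r tx := by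
  obtain rfl | ⟨u, hu, σs, he⟩ := hE.echoes_of_mem_trHist hp h
  · simp [𝒯.init_issuer] at hi
  · obtain ⟨-, s, hd, -⟩ := hE.echoes_of_sent hp he.1 (he.2 p)
    obtain rfl : s = r := Option.some.inj (hd.1.symm.trans hi)
    obtain ⟨w, hw, hiss⟩ := hE.issues_of_signed hr (he.2 p) (e := (tx, σs))
      (by simp [Message.signed]) hi hd.2.1
    exact ⟨w, by omega, hiss⟩

end Execution.Admissible

end SpendingAssetTransfer

/-! ### Well-formed histories, the spending bound, conviction and liveness -/

namespace SpendingAssetTransfer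

variable {P Tx Sig : Type*} [Fintype P] {M : TrustModel P} {𝒯 : TxSystem P Tx}
  {sg : SigScheme P Tx Sig} {F : Set P} {E : Execution P Tx Sig}

/-- The supremum in `ℕ` is meaningful only for a bounded set; the number of processes is a bound. -/
theorem TrustModel.indepNum_le_inconsistencyNumber {F : Set P} (hF : F ∈ M.faults)
    {S : P → Set P} (hS : M.IsSelection S) :
    (trustGraph F S).indepNum ≤ M.inconsistencyNumber := by
  classical
  refine le_csSup ⟨Fintype.card P, ?_⟩ ⟨F, hF, S, hS, rfl⟩
  rintro m ⟨F', -, S', -, rfl⟩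
  obtain ⟨s, hs⟩ := (trustGraph F' S').exists_isNIndepSet_indepNum
  rw [← hs.card_eq]
  exact (Finset.card_le_univ s).trans (Fintype.card_subtype_le _)

/-- Accepting a ready transaction keeps a history well-formed and free of circular dependencies. -/
theorem TxSystem.WellFormed.insert_ready {st : LocalState P Tx Sig} {tx : Tx}
    (h : 𝒯.WellFormed st.trHist) (hc : ∀ y ∈ st.trHist, ¬ 𝒯.DependsOn y y)
    (hr : Ready 𝒯 st tx) :
    𝒯.WellFormed (st.trHist ∪ {tx}) ∧ ∀ y ∈ st.trHist ∪ {tx}, ¬ 𝒯.DependsOn y y := by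
  by_cases htx : tx ∈ st.trHist
  · rw [Set.union_eq_self_of_subset_right (Set.singleton_subset_iff.2 htx)]
    exact ⟨h, hc⟩
  obtain ⟨hin, hval, hfresh⟩ := hr
  have hcyc : ∀ y ∈ st.trHist ∪ {tx}, ¬ 𝒯.DependsOn y y := by
    rintro y (hy | rfl) hd
    · exact hc y hy hd
    -- A cycle through the new transaction enters it from one of its inputs. The history is closed
    -- under inputs, so following the cycle backwards would put the transaction in the history
    -- already.
    · obtain ⟨x, hx, hxy⟩ := Relation.TransGen.tail'_iff.1 hd
      rcases Relation.reflTransGen_iff_eq_or_transGen.1 hx with rfl | hx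
      · exact htx (hin _ hxy)
      · exact htx (mem_of_dependsOn h.complete hx (hin _ hxy))
  have hnc : ∀ y ∈ st.trHist, ¬ 𝒯.Conflict tx y := fun y hy ⟨_, hi, x, hx, hx'⟩ =>
    hfresh y hy hi x hx hx'
  refine ⟨⟨Or.inl h.init_mem, ?_, ?_, ?_, ?_⟩, hcyc⟩
  · rintro y (hy | rfl) hne
    · exact h.valid y hy hne
    · exact hval
  · rintro y (hy | rfl) x hx
    · exact Or.inl (h.complete y hy x hx)
    · exact Or.inl (hin x hx)
  · rintro y (hy | rfl) z (hz | rfl) hcf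
    · exact h.no_conflict y hy z hz hcf
    · exact hnc y hy hcf.symm
    · exact hnc z hz hcf
    · exact hcf.1 rfl
  · intro y hy z hz hd hyz
    exact hcyc y hy (Relation.TransGen.head hyz hd)

namespace Execution.Admissible

/-- The absence of self-dependence is carried along because it passes through the induction and
yields `cycle_free`. -/
theorem wellFormed (hE : E.Admissible M 𝒯 sg F) {p : P} (hp : p ∉ F) (t : ℕ) :
    𝒯.WellFormed (E.state t p).trHist ∧ ∀ y ∈ (E.state t p).trHist, ¬ 𝒯.DependsOn y y := by
  induction t with
  | zero =>
    have hno : ∀ y, ¬ 𝒯.DependsOn 𝒯.init y := by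
      intro y hd
      obtain ⟨x, -, hx⟩ := Relation.TransGen.tail'_iff.1 hd
      simp [𝒯.init_inputs] at hx
    rw [hE.init p hp]
    refine ⟨⟨rfl, ?_, ?_, ?_, ?_⟩, ?_⟩
    · rintro y rfl hne
      exact absurd rfl hne
    · rintro y rfl x hx
      simp [𝒯.init_inputs] at hx
    · rintro y rfl z rfl hc
      exact hc.1 rfl
    · rintro y rfl z - hd
      exact absurd hd (hno z)
    · rintro y rfl
      exact hno _
  | succ n ih =>
    rcases hE.state_succ hp n with h | ⟨rfl, h⟩
    · rwa [h]
    · rcases trHist_step (𝒯 := 𝒯) (sg := sg) (E.proc n) (E.state n (E.proc n)) (E.act n)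
        with h' | ⟨tx, ha, h'⟩
      · rwa [h, h']
      · rw [h, h']
        have hen := hE.enabled n hp
        rw [ha] at hen
        exact ih.1.insert_ready ih.2 hen.2

theorem kSpending (hE : E.Admissible M 𝒯 sg F) (hF : F ∈ M.faults) (t : ℕ) :
    𝒯.spendingNumber {H | ∃ p, p ∉ F ∧ H = (E.state t p).trHist} ≤ M.inconsistencyNumber := by
  classical
  refine iSup_le fun r => iSup_le fun tx => iSup_le fun _ => ?_
  set A := 𝒯.spends {H | ∃ p, p ∉ F ∧ H = (E.state t p).trHist} r tx
  have hA : ∀ a : A, ∃ p : {p // p ∉ F}, (a : Tx) ∈ (E.state t p).trHist := by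
    rintro ⟨a, _, ⟨p, hp, rfl⟩, ha, -, -⟩
    exact ⟨⟨p, hp⟩, ha⟩
  choose f hf using hA
  have hconf : ∀ a b : A, a ≠ b → 𝒯.Conflict (a : Tx) b := by
    rintro ⟨a, _, _, _, hx, hi⟩ ⟨b, _, _, _, hx', hi'⟩ hne
    exact ⟨fun h => hne (Subtype.ext h), hi.trans hi'.symm, tx, hx, hx'⟩
  -- Two spends of the same output conflict, so no single history contains both.
  have hinj : Function.Injective f := by
    intro a b hab
    by_contra hne
    exact (hE.wellFormed (f a).2 t).1.no_conflict a (hf a) b (hab ▸ hf b) (hconf a b hne)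
  -- A process `f a` gets the quorum that led it to accept `a`, which is unambiguous by injectivity;
  -- any other process gets an arbitrary quorum.
  have hS : ∀ p : P, ∃ Q ∈ M.quorums p, ∀ a : A, (f a : P) = p →
      ∀ q ∈ Q, q ∉ F → ∃ u σ, Echoes E sg u q (a : Tx) σ := by
    intro p
    by_cases h : ∃ a, (f a : P) = p
    · obtain ⟨a, rfl⟩ := h
      obtain h | ⟨u, -, Q, hQ, hq⟩ := hE.quorum_of_mem_trHist (f a).2 (hf a)
      · obtain ⟨_, -, -, hx, -⟩ := a.2
        simp [h, 𝒯.init_inputs] at hx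
      · refine ⟨Q, hQ, fun b hb q hqQ hqF => ?_⟩
        obtain rfl : b = a := hinj (Subtype.ext hb)
        obtain ⟨w, -, h⟩ := hE.echoes_origin (f b).2 hqF (hq q hqQ)
        exact ⟨w, h⟩
    · obtain ⟨Q, hQ⟩ := M.quorums_nonempty p
      exact ⟨Q, hQ, fun a ha => absurd ⟨a, ha⟩ h⟩
  choose S hSel hecho using hS
  have hind : (trustGraph F S).IsIndepSet ((Set.range f).toFinset : Set {p // p ∉ F}) := by
    rw [Set.coe_toFinset]
    rintro _ ⟨a, rfl⟩ _ ⟨b, rfl⟩ hne ⟨-, hadj⟩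
    obtain ⟨q, ⟨hqa, hqb⟩, hqF⟩ := Set.not_subset.1 hadj
    obtain ⟨u, σ, ha⟩ := hecho _ a rfl q hqa hqF
    obtain ⟨u', σ', hb⟩ := hecho _ b rfl q hqb hqF
    exact hE.not_conflict_of_echoes hqF ha hb (hconf a b fun h => hne (h ▸ rfl))
  have hcard := hind.card_le_indepNum.trans (M.indepNum_le_inconsistencyNumber hF hSel)
  -- The range lies in a finite type, so finiteness of `A` need not be known beforehand.
  calc A.encard = (Set.range f).encard := by
        rw [← Set.image_univ, hinj.encard_image, Set.encard_univ, Set.encard]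
    _ = ((Set.range f).toFinset.card : ℕ∞) := by
        rw [← Set.encard_coe_eq_coe_finsetCard, Set.coe_toFinset]
    _ ≤ M.inconsistencyNumber := by exact_mod_cast hcard

/-- Both accepting processes echoed what they accepted, so `r` receives both signed requests and can
form the accusation from its own state. -/
theorem eventualConviction (hE : E.Admissible M 𝒯 sg F) {p q r : P} (hp : p ∉ F) (hq : q ∉ F)
    (hr : r ∉ F) {t t' : ℕ} {tx tx' : Tx} (h : tx ∈ (E.state t p).trHist)
    (h' : tx' ∈ (E.state t' q).trHist) (hc : 𝒯.Conflict tx tx') :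
    ∃ u, ∃ a ∈ (E.state u r).acHist, RefersTo 𝒯 sg a tx ∧ RefersTo 𝒯 sg a tx' := by
  obtain ⟨x, hx, hx'⟩ := hc.2.2
  obtain rfl | ⟨u, -, σ, he⟩ := hE.echoes_of_mem_trHist hp h
  · simp [𝒯.init_inputs] at hx
  obtain rfl | ⟨u', -, σ', he'⟩ := hE.echoes_of_mem_trHist hq h'
  · simp [𝒯.init_inputs] at hx'
  obtain ⟨w, s, -, hs⟩ := hE.echoes_received hp hr he
  obtain ⟨w', s', -, hs'⟩ := hE.echoes_received hq hr he'
  obtain rfl : s = s' := Option.some.inj ((hE.issuer_of_mem_signedRequests hr hs).1.symm.trans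
    (hc.2.1.trans (hE.issuer_of_mem_signedRequests hr hs').1))
  exact hE.exists_accusation hr hr hs hs' hc.1 hc.2.2

/-- A valid transaction whose request reaches all correct processes is accepted by a live process
that accepts its inputs, or its issuer is accused of it. -/
theorem accepts_or_accuses (hE : E.Admissible M 𝒯 sg F) {q : P} (hq : q ∉ F) (hl : M.Live F q)
    {tx : Tx} (hval : 𝒯.Valid tx)
    (hreq : ∀ c, c ∉ F → ∃ u s σ, (tx, σ) ∈ (E.state u c).signedRequests s)
    (hinp : ∀ x ∈ 𝒯.inputs tx, ∃ u, x ∈ (E.state u q).trHist) :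
    (∃ u, tx ∈ (E.state u q).trHist) ∨ ∃ u, ∃ a ∈ (E.state u q).acHist, RefersTo 𝒯 sg a tx := by
  by_contra! hcon
  obtain ⟨hT, hA⟩ := hcon
  obtain ⟨Q, hQ, hQF⟩ := hl
  have hqecho : ∀ c ∈ Q, ∀ᶠ u in Filter.atTop, tx ∈ (E.state u q).echoes c := by
    intro c hcQ
    have hc : c ∉ F := Set.disjoint_left.1 hQF hcQ
    obtain ⟨u, s, σ, hs⟩ := hreq c hc
    rcases hE.echoes_or_conflict hc hs with ⟨w, σ', he⟩ | ⟨w, e, hes, hne, hx⟩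
    · obtain ⟨v, -, hv, -⟩ := hE.echoes_received hc hq he
      filter_upwards [Filter.eventually_ge_atTop v] with n hn
      exact (hE.state_le hq hn).echoes c hv
    · obtain ⟨v, a, ha, href, -⟩ := hE.exists_accusation hc hq hs hes hne hx
      exact absurd href (hA v a ha)
  -- The quorum is finite, so the echoes of all its members are present from some common time on.
  obtain ⟨t, ht⟩ := Filter.eventually_atTop.1
    ((Filter.eventually_all_finite (Set.toFinite Q)).2 hqecho)
  have hpend : ∃ w, tx ∈ (E.state w q).pending := by
    obtain ⟨w, hw, hfair | ⟨rfl, hact⟩⟩ := hE.fair_collect q hq tx t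
    · by_contra! hn
      exact hfair ⟨⟨Q, hQ, ht w hw⟩, hT w, hn w⟩
    · refine ⟨w + 1, ?_⟩
      rw [hE.next w hq, hact]
      simp [step]
  obtain ⟨w, hw⟩ := hpend
  have hinp' : ∀ x ∈ (𝒯.inputs tx : Set Tx), ∀ᶠ u in Filter.atTop, x ∈ (E.state u q).trHist := by
    intro x hx
    obtain ⟨u, hu⟩ := hinp x hx
    filter_upwards [Filter.eventually_ge_atTop u] with n hn
    exact (hE.state_le hq hn).trHist hu
  obtain ⟨t', ht'⟩ := Filter.eventually_atTop.1
    ((Filter.eventually_all_finite (Finset.finite_toSet _)).2 hinp')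
  obtain ⟨v, hv, hfair | ⟨rfl, hact⟩⟩ := hE.fair_accept q hq tx (max w t')
  -- A pending transaction can leave `pending` only for the history, which is excluded here. What
  -- remains is to rule out a blocking rival in the history of `q`.
  · refine hfair ⟨((hE.state_le hq ((le_max_left _ _).trans hv)).pending hw).resolve_right (hT v),
      ht' v ((le_max_right _ _).trans hv), hval, fun tx' htx' hi x hx hx' => ?_⟩
    have hne : tx ≠ tx' := fun h => hT v (h ▸ htx')
    obtain ⟨u, s, σ, hs⟩ := hreq q hq
    obtain rfl | ⟨u', -, σ', he'⟩ := hE.echoes_of_mem_trHist hq htx'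
    · simp [𝒯.init_inputs] at hx'
    -- The process `q` receives its own echo of the rival, so it holds both signed requests and an
    -- accusation against the issuer follows.
    obtain ⟨w', s', -, hs'⟩ := hE.echoes_received hq hq he'
    obtain rfl : s = s' := Option.some.inj ((hE.issuer_of_mem_signedRequests hq hs).1.symm.trans
      (hi.trans (hE.issuer_of_mem_signedRequests hq hs').1))
    obtain ⟨n, a, ha, href, -⟩ := hE.exists_accusation hq hq hs hs' hne ⟨x, hx, hx'⟩
    exact hA n a ha href
  · apply hT (v + 1)
    rw [hE.next v hq, hact]
    simp [step]

theorem termination (hE : E.Admissible M 𝒯 sg F) {p q : P} (hp : p ∉ F) (hq : q ∉ F)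
    (hl : M.Live F q) {t : ℕ} {tx : Tx} (h : tx ∈ (E.state t p).trHist) :
    (∃ u, tx ∈ (E.state u q).trHist) ∨ ∃ u, ∃ a ∈ (E.state u q).acHist,
      ∃ tx', (tx' = tx ∨ 𝒯.DependsOn tx tx') ∧ RefersTo 𝒯 sg a tx' := by
  -- The inputs were in the history of `p` strictly before `tx` was accepted, so time serves as the
  -- rank for descending through dependencies.
  induction t using Nat.strong_induction_on generalizing tx with
  | _ t ih =>
    obtain rfl | ⟨u, hu, -, hin, hval, -⟩ := hE.trHist_origin hp h
    · exact Or.inl ⟨0, (hE.wellFormed hq 0).1.init_mem⟩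
    by_cases hinp : ∀ x ∈ 𝒯.inputs tx, ∃ u, x ∈ (E.state u q).trHist
    · obtain rfl | ⟨w, -, σ, he⟩ := hE.echoes_of_mem_trHist hp h
      · exact Or.inl ⟨0, (hE.wellFormed hq 0).1.init_mem⟩
      refine (hE.accepts_or_accuses hq hl hval (fun c hc => ?_) hinp).imp_right
        fun ⟨n, a, ha, href⟩ => ⟨n, a, ha, tx, Or.inl rfl, href⟩
      obtain ⟨v, s, -, hs⟩ := hE.echoes_received hp hc he
      exact ⟨v, s, σ, hs⟩
    · push Not at hinp
      obtain ⟨x, hx, hno⟩ := hinp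
      obtain ⟨v, hv⟩ | ⟨v, a, ha, tx', htx', href⟩ := ih u hu (hin x hx)
      · exact absurd hv (hno v)
      · refine Or.inr ⟨v, a, ha, tx', Or.inr ?_, href⟩
        rcases htx' with rfl | hd
        · exact .single hx
        · exact hd.tail hx

theorem validity (hE : E.Admissible M 𝒯 sg F) {p q : P} (hp : p ∉ F) (hq : q ∉ F)
    (hl : M.Live F q) {t : ℕ} {tx : Tx} (h : E.Issues t p tx) :
    (∃ u, tx ∈ (E.state u q).trHist) ∨ ∃ u, ∃ a ∈ (E.state u q).acHist,
      ∃ tx', 𝒯.DependsOn tx tx' ∧ RefersTo 𝒯 sg a tx' := by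
  obtain ⟨hi, hval, hin, -⟩ := hE.client t p tx hp h
  by_cases hinp : ∀ x ∈ 𝒯.inputs tx, ∃ u, x ∈ (E.state u q).trHist
  · refine Or.inl ((hE.accepts_or_accuses hq hl hval (fun c hc => ?_) hinp).resolve_right ?_)
    · have hm : .req tx (sg.sign p tx) ∈ E.sent t c := by
        rw [hE.mem_sent hp h.1, h.2]
        simp [step]
      obtain ⟨u, hu⟩ := hE.receives hp hc h.1 hm
      exact ⟨u + 1, p, _, by rw [hu]; exact receive_req_step hi (sg.verify_sign _ _)⟩
    -- An accusation referring to `tx` would accuse its issuer `p`, which is correct; hence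
    -- validity, unlike termination, needs no exception for `tx` itself.
    · rintro ⟨u, a, ha, r, hr, e, -, e', -, rfl, hev⟩
      obtain ⟨hv, w, -, -, hs⟩ := hE.acHist_origin hq ha
      obtain rfl : p = r := Option.some.inj (hi.symm.trans hev.1)
      exact hp (hE.subset_faulty_of_sent (hs q) hv hr)
  · push Not at hinp
    obtain ⟨x, hx, hno⟩ := hinp
    obtain ⟨v, hv⟩ | ⟨v, a, ha, tx', htx', href⟩ := hE.termination hp hq hl (hin x hx)
    · exact absurd hv (hno v)
    · refine Or.inr ⟨v, a, ha, tx', ?_, href⟩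
      rcases htx' with rfl | hd
      · exact .single hx
      · exact hd.tail hx

end Execution.Admissible

end SpendingAssetTransfer

theorem mainTheorem1 {P Tx Sig : Type*} [Fintype P]
    (M : SpendingAssetTransfer.TrustModel P)
    (𝒯 : SpendingAssetTransfer.TxSystem P Tx)
    (sg : SpendingAssetTransfer.SigScheme P Tx Sig)
    (kmax : ℕ) (hk : M.inconsistencyNumber = kmax)
    (F : Set P) (hF : F ∈ M.faults)
    (E : SpendingAssetTransfer.Execution P Tx Sig)
    (hE : E.Admissible M 𝒯 sg F) :
    SpendingAssetTransfer.IsKSpendingAssetTransfer M 𝒯 sg F kmax E.trace := by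
  constructor
  case wellFormed => exact fun p hp t => (hE.wellFormed hp t).1
  case validity => exact fun t p tx hp h q hq hl => hE.validity hp hq hl h
  case kSpending => exact fun t => hk ▸ hE.kSpending hF t
  case eventualConviction =>
    intro p q hp hq t t' tx tx' h h' hc r hr
    have hrF : r ∉ F := by rcases hr with rfl | rfl <;> assumption
    obtain ⟨u, a, ha, h1, h2⟩ := hE.eventualConviction hp hq hrF h h' hc
    exact ⟨⟨u, a, ha, h1⟩, ⟨u, a, ha, h2⟩⟩
  case accuracy =>
    intro p hp t a ha
    obtain ⟨hv, u, -, -, hs⟩ := hE.acHist_origin hp ha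
    exact ⟨hv, fun _ => hE.subset_faulty_of_sent (hs p) hv, fun _ => hv⟩
  case accuracy_exhibited =>
    rintro a ⟨t, q, h⟩ hv
    exact hE.subset_faulty_of_sent h hv
  case agreement => exact fun p hp t a ha q hq => hE.acHist_agreement hp hq ha
  case integrity => exact fun p hp t tx h r hr hi => hE.integrity hp hr h hi
  case monotonicity => exact fun p hp t t' h => (hE.state_le hp h).acHist
  case termination => exact fun p hp t tx h q hq hl => hE.termination hp hq hl h
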